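/- Let $m,d\in\mathbb{N}$, let $\Theta\subseteq\mathbb{R}^m$ be nonempty and compact, let $\mathbb{P}^Z$ be a Borel probability measure on $\mathbb{R}^d$ (the law of a random vector $Z$), and let $G:\Theta\times\mathbb{R}^d\to\mathbb{R}$ be of the piecewise linear form $$G(\theta,z)=\sum_{i=1}^r f^i(\theta,z)\,G^i(\theta,z),\qquad f^i(\theta,z)=\min_{1\le l\le s_i}\mathbf 1_{I_{il}}\big(L^i_l(T(\theta)+z)+a^i_l\big),\qquad G^i(\theta,z)=\Lambda_i(T(\theta)+z)+b_i,$$ where $r,s_1,\dots,s_r\ge 1$ are integers, $a^i_l,b_i\in\mathbb{R}$, the maps $\Lambda_i,L^i_l:\mathbb{R}^d\to\mathbb{R}$ and $T:\mathbb{R}^m\to\mathbb{R}^d$ are linear, $]0,\infty[\,\subseteq I_{il}\subseteq[0,\infty[$, and for all $\theta\in\Theta$, $z\in\mathbb{R}^d$ one has $f^i(\theta,z)f^j(\theta,z)=0$ for $i\ne j$ and $\sum_{i=1}^r f^i(\theta,z)=1$. An envelope of a class $\mathbb{F}$ of real functions on $\mathbb{R}^d$ is a Borel measurable $C:\mathbb{R}^d\to\mathbb{R}$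 with $|h|\le C$ for all $h\in\mathbb{F}$; it is positive if $C>0$ everywhere. For a probability measure $\mathbb{Q}$ on $\mathbb{R}^d$, $N(\eta,\mathbb{F},L^2(\mathbb{Q}))\in\mathbb{N}_0\cup\{\infty\}$ is the minimal number of closed $L^2(\mathbb{Q})$-balls of radius $\eta$ with centers in $\mathbb{F}$ needed to cover $\mathbb{F}$, and $$J(\mathbb{F},C,\delta)=\int_0^\delta\ \sup_{\mathbb{Q}}\sqrt{\ln\big(2N(\varepsilon\|C\|_{L^2(\mathbb{Q})},\mathbb{F},L^2(\mathbb{Q}))\big)}\,d\varepsilon\in[0,\infty],$$ the supremum being over all Borel probability measures $\mathbb{Q}$ on $\mathbb{R}^d$ with finite support. Put $\mathbb{F}^\Theta=\{G(\theta,\cdot)\mid\theta\in\Theta\}$, $S_i=\sup_{\theta\in\Theta}|\Lambda_i(T(\theta))+b_i|$ and $\eta_i^G=S_i+\mathbf 1_{\{0\}}(S_i)$. Then: 1. For all $\theta\in\Theta$ and $i\in\{1,\dots,r\}$ the functions $f^i(\theta,\cdot)$ and $G^i(\theta,\cdot)$ are Borel measurable; in particular (A1) holds: $G(\theta,\cdot)$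 is Borel measurable for every $\theta\in\Theta$. 2. If $\Lambda_1,\dots,\Lambda_r$ are square $\mathbb{P}^Z$-integrable and, for each $i$, $\xi_i$ is a bounded positive envelope of $\{f^i(\theta,\cdot)\mid\theta\in\Theta\}$, then $\xi:=\sum_{i=1}^r\xi_i\,(|\Lambda_i|+\eta_i^G)$ is square $\mathbb{P}^Z$-integrable, it satisfies (A2), i.e. it is a $\mathbb{P}^Z$-integrable positive envelope of $\mathbb{F}^\Theta$, and for every $\delta\in\,]0,1]$ $$J(\mathbb{F}^\Theta,\xi,\delta)\le 2\delta\sqrt{\sum_{i=1}^r\ln(s_i+1)+\Big[8\sum_{i=1}^r s_i+30r+1\Big]\ln 2+2\Big[\sum_{i=1}^r s_i+3r\Big]\Big[\tfrac12+\ln(r/\delta)\Big]}.$$ -/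

import Mathlib

open MeasureTheory
open scoped ENNReal

noncomputable section

namespace SAA

/-- Euclidean space of dimension `n`. -/
abbrev E (n : ℕ) : Type := EuclideanSpace ℝ (Fin n)

/-! ### Envelopes, covering numbers, entropy integrals -/

/-- `C` is an envelope of the class `F` of functions on `ℝᵈ`: it is Borel measurable and
`sup_{h ∈ F} |h| ≤ C` pointwise. -/
def IsEnvelope {d : ℕ} (F : Set (E d → ℝ)) (C : E d → ℝ) : Prop :=
  Measurable C ∧ ∀ h ∈ F, ∀ z, |h z| ≤ C z

/-- An envelope with strictly positive values. -/
def IsPositiveEnvelope {d : ℕ} (F : Set (E d → ℝ)) (C : E d → ℝ) : Prop :=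
  IsEnvelope F C ∧ ∀ z, 0 < C z

/-- The Borel probability measures on `ℝᵈ` with finite support. -/
def finSuppProb (d : ℕ) : Set (Measure (E d)) :=
  {Q | IsProbabilityMeasure Q ∧ ∃ S : Finset (E d), Q ((S : Set (E d))ᶜ) = 0}

/-- `N(η, F, Lᵖ(Q))`: the minimal number of closed `Lᵖ(Q)`-balls of radius `η` with centers
in `F` that cover `F`; it is `⊤` if there is no finite cover. -/
def coveringNumber {d : ℕ} (η : ℝ≥0∞) (F : Set (E d → ℝ)) (p : ℝ≥0∞) (Q : Measure (E d)) : ℕ∞ :=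
  ⨅ (c : Finset (E d → ℝ)) (_ : (c : Set (E d → ℝ)) ⊆ F ∧
      ∀ h ∈ F, ∃ g ∈ c, eLpNorm (h - g) p Q ≤ η), (c.card : ℕ∞)

/-- `√(ln (2 N))`, with value `∞` for `N = ∞`. -/
def sqrtLogTwoMul (N : ℕ∞) : ℝ≥0∞ :=
  if N = ⊤ then ⊤ else ENNReal.ofReal (Real.sqrt (Real.log (2 * (N.toNat : ℝ))))

/-- The entropy integral
`J(F, C, δ) = ∫₀^δ sup_Q √(ln (2 N(ε ‖C‖_{Q,2}, F, L²(Q)))) dε`, where `Q` ranges over the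
probability measures with finite support; an element of `[0, ∞]`. -/
def entropyIntegral {d : ℕ} (F : Set (E d → ℝ)) (C : E d → ℝ) (δ : ℝ) : ℝ≥0∞ :=
  ∫⁻ ε in Set.Ioc (0 : ℝ) δ,
    ⨆ Q ∈ finSuppProb d, sqrtLogTwoMul (coveringNumber (ENNReal.ofReal ε * eLpNorm C 2 Q) F 2 Q)

/-! ### Conditions on the goal function -/

/-- The function class `F^Θ = {G(θ, ·) | θ ∈ Θ}`. -/
def goalClass {m d : ℕ} (Θ : Set (E m)) (G : E m → E d → ℝ) : Set (E d → ℝ) :=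
  {h | ∃ θ ∈ Θ, h = G θ}

/-- Condition (A 1): `G(θ, ·)` is Borel measurable for every `θ ∈ Θ`. -/
def CondA1 {m d : ℕ} (Θ : Set (E m)) (G : E m → E d → ℝ) : Prop :=
  ∀ θ ∈ Θ, Measurable (G θ)

/-- Condition (A 2) with the mapping `ξ`: `ξ` is a `μ`-integrable positive envelope
of `F^Θ`. -/
def CondA2 {m d : ℕ} (Θ : Set (E m)) (G : E m → E d → ℝ) (μ : Measure (E d))
    (ξ : E d → ℝ) : Prop :=
  IsPositiveEnvelope (goalClass Θ G) ξ ∧ Integrable ξ μ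

/-- The parameters of a piecewise linear representation: the numbers `r, s₁, …, s_r ≥ 1`,
the reals `a^i_l`, `b_i`, the linear mappings `L^i_l`, `Λ_i`, `T`, and the half-lines `I_{il}`,
each of which is `]0, ∞[` or `[0, ∞[`. -/
structure PLData (m d : ℕ) where
  r : ℕ
  r_pos : 1 ≤ r
  s : Fin r → ℕ
  s_pos : ∀ i, 1 ≤ s i
  a : (i : Fin r) → Fin (s i) → ℝ
  b : Fin r → ℝ
  L : (i : Fin r) → Fin (s i) → (E d →ₗ[ℝ] ℝ)
  Λ : Fin r → (E d →ₗ[ℝ] ℝ)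
  T : E m →ₗ[ℝ] E d
  I : (i : Fin r) → Fin (s i) → Set ℝ
  Ioi_subset : ∀ i l, Set.Ioi 0 ⊆ I i l
  subset_Ici : ∀ i l, I i l ⊆ Set.Ici 0

namespace PLData

variable {m d : ℕ} (D : PLData m d)

/-- `f^i(θ, z) = min_l 1_{I_{il}}(L^i_l(T θ + z) + a^i_l)`. -/
def f (i : Fin D.r) (θ : E m) (z : E d) : ℝ :=
  ⨅ l : Fin (D.s i), (D.I i l).indicator (fun _ => (1 : ℝ)) (D.L i l (D.T θ + z) + D.a i l)

/-- `G^i(θ, z) = Λ_i(T θ + z) + b_i`. -/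
def Gpart (i : Fin D.r) (θ : E m) (z : E d) : ℝ :=
  D.Λ i (D.T θ + z) + D.b i

/-- Condition (PL): on `Θ × ℝᵈ` the goal function is `G = ∑ i, f^i G^i`, and the
indicators `f^i` are mutually exclusive and add up to one. -/
structure Represents (Θ : Set (E m)) (G : E m → E d → ℝ) : Prop where
  eq_sum : ∀ θ ∈ Θ, ∀ z, G θ z = ∑ i, D.f i θ z * D.Gpart i θ z
  disjoint : ∀ i j, i ≠ j → ∀ θ ∈ Θ, ∀ z, D.f i θ z * D.f j θ z = 0
  sum_one : ∀ θ ∈ Θ, ∀ z, ∑ i, D.f i θ z = 1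

/-- `sup_{θ ∈ Θ} |Λ_i(T θ) + b_i|` (finite for compact `Θ`). -/
def supConst (Θ : Set (E m)) (i : Fin D.r) : ℝ :=
  sSup ((fun θ => |D.Λ i (D.T θ) + D.b i|) '' Θ)

/-- `η_i^G = sup_{θ ∈ Θ} |Λ_i(T θ) + b_i| + 1_{0}(sup_{θ ∈ Θ} |Λ_i(T θ) + b_i|)`. -/
def etaG (Θ : Set (E m)) (i : Fin D.r) : ℝ :=
  D.supConst Θ i + Set.indicator {(0 : ℝ)} (fun _ => (1 : ℝ)) (D.supConst Θ i)

/-- `ξ = ∑ i, ξ_i (|Λ_i| + η_i^G)`. -/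
def envelope (Θ : Set (E m)) (ξ : Fin D.r → E d → ℝ) (z : E d) : ℝ :=
  ∑ i, ξ i z * (|D.Λ i z| + D.etaG Θ i)

end PLData

end SAA

end

namespace SAA

/-! ### Colouring intersections of chains -/

/-- Sets of a finite measure space that are intersections of `s` members of chains can be
coloured with `(K + s).choose s` colours such that sets of equal colour are close. -/
theorem exists_colouring_iInter_chains {Ω ι : Type*} [MeasurableSpace Ω] {η : ℝ} (hη : 0 < η)
    (s : ℕ) : ∀ (K : ℕ) (μ : Measure Ω) [IsFiniteMeasure μ] (B : Fin s → ι → Set Ω),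
      (∀ l i, MeasurableSet (B l i)) → (∀ l i j, B l i ⊆ B l j ∨ B l j ⊆ B l i) →
      μ.real Set.univ < (K + 1) * η →
      ∃ c : ι → Fin ((K + s).choose s), ∀ i j, c i = c j →
        μ.real (symmDiff (⋂ l, B l i) (⋂ l, B l j)) ≤ 2 * s * η := by
  induction s with
  | zero =>
    intro K μ _ B _ _ _
    exact ⟨fun _ => ⟨0, by simp⟩, fun i j _ => by simp⟩
  | succ s ih =>
    intro K μ _ B hm hc hK
    have hnn : ∀ i, 0 ≤ μ.real (B 0 i)ᶜ / η := fun i => div_nonneg measureReal_nonneg hη.le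
    have hlt : ∀ i, ⌊μ.real (B 0 i)ᶜ / η⌋₊ < K + 1 := by
      intro i
      rw [Nat.floor_lt (hnn i), div_lt_iff₀ hη]
      push_cast
      exact (measureReal_mono (Set.subset_univ _)).trans_lt hK
    -- Buckets use the mass of the complement, so a high bucket leaves little mass for the remaining
    -- chains.
    let k : ι → Fin (K + 1) := fun i => ⟨⌊μ.real (B 0 i)ᶜ / η⌋₊, hlt i⟩
    have hdist : ∀ i j, k i = k j → μ.real (symmDiff (B 0 i) (B 0 j)) ≤ η := by
      have aux : ∀ i j, k i = k j → B 0 i ⊆ B 0 j →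
          μ.real (symmDiff (B 0 i) (B 0 j)) ≤ η := by
        intro i j hij hsub
        have h0 : ⌊μ.real (B 0 i)ᶜ / η⌋₊ = ⌊μ.real (B 0 j)ᶜ / η⌋₊ := congrArg Fin.val hij
        have h1 := Nat.lt_floor_add_one (μ.real (B 0 i)ᶜ / η)
        have h2 := Nat.floor_le (hnn j)
        rw [h0] at h1
        rw [div_lt_iff₀ hη] at h1
        rw [le_div_iff₀ hη] at h2
        have h3 : symmDiff (B 0 i) (B 0 j) = (B 0 i)ᶜ \ (B 0 j)ᶜ := by
          rw [symmDiff_of_le hsub]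
          ext x
          simp only [Set.mem_sdiff, Set.mem_compl_iff, not_not]
          tauto
        rw [h3, measureReal_sdiff (Set.compl_subset_compl.2 hsub) (hm 0 j).compl]
        linarith
      intro i j hij
      rcases hc 0 i j with h | h
      · exact aux i j hij h
      · rw [symmDiff_comm]
        exact aux j i hij.symm h
    have hk : ∀ q : Fin (K + 1), ∃ c : ι → Fin ((K - q + s).choose s), ∀ i j, k i = q → k j = q →
        c i = c j →
        μ.real (symmDiff (⋂ l, B l i) (⋂ l, B l j)) ≤ 2 * (s + 1 : ℕ) * η := by
      intro q
      by_cases hq : ∃ i₀, k i₀ = q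
      · obtain ⟨i₀, h0⟩ := hq
        -- In bucket `q` the complement has mass at least `q η`, so `K` drops to `K - q` on the
        -- reference set `B 0 i₀`.
        have hmass : (μ.restrict (B 0 i₀)).real Set.univ < ((K - q : ℕ) + 1) * η := by
          have h2 := Nat.floor_le (hnn i₀)
          rw [le_div_iff₀ hη] at h2
          have h1 : ⌊μ.real (B 0 i₀)ᶜ / η⌋₊ = (q : ℕ) := congrArg Fin.val h0
          rw [h1] at h2
          have h3 := measureReal_add_measureReal_compl (μ := μ) (hm 0 i₀)
          rw [measureReal_restrict_apply_univ, Nat.cast_sub (Nat.lt_succ_iff.1 q.2)]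
          linarith
        obtain ⟨c, hcc⟩ := ih (K - q) (μ.restrict (B 0 i₀)) (fun l => B l.succ)
          (fun l => hm l.succ) (fun l => hc l.succ) hmass
        refine ⟨c, fun i j hi hj hij => ?_⟩
        have h1 := hdist i i₀ (hi.trans h0.symm)
        have h2 := hdist j i₀ (hj.trans h0.symm)
        have h3 := hcc i j hij
        have hmI : ∀ i, MeasurableSet (⋂ l : Fin s, B l.succ i) :=
          fun i => MeasurableSet.iInter fun l => hm _ _
        rw [measureReal_restrict_apply ((hmI i).symmDiff (hmI j))] at h3
        -- Replacing both first sets by `B 0 i₀` costs `η` each; the rest is the inductive error `2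
        -- s η`.
        have hsub : symmDiff (⋂ l, B l i) (⋂ l, B l j) ⊆
            (symmDiff (B 0 i) (B 0 i₀) ∪ symmDiff (B 0 j) (B 0 i₀)) ∪
            (symmDiff (⋂ l : Fin s, B l.succ i) (⋂ l : Fin s, B l.succ j) ∩ B 0 i₀) := by
          intro x hx
          simp only [Set.mem_symmDiff, Set.mem_iInter, Fin.forall_fin_succ, Set.mem_union,
            Set.mem_inter_iff] at hx ⊢
          tauto
        have h4 := (measureReal_mono (μ := μ) hsub).trans
          ((measureReal_union_le _ _).trans (add_le_add_left (measureReal_union_le _ _) _))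
        push_cast
        linarith
      · exact ⟨fun _ => ⟨0, Nat.choose_pos (by omega)⟩, fun i j hi => (hq ⟨i, hi⟩).elim⟩
    choose c hcc using hk
    -- The bucket counts add up by the hockey-stick identity.
    have hcard : Fintype.card (Σ q : Fin (K + 1), Fin ((K - q + s).choose s)) =
        (K + (s + 1)).choose (s + 1) := by
      rw [Fintype.card_sigma]
      simp only [Fintype.card_fin]
      rw [Fin.sum_univ_eq_sum_range (fun q => (K - q + s).choose s) (K + 1),
        ← Finset.sum_range_reflect, ← add_assoc, ← Nat.sum_range_add_choose]
      refine Finset.sum_congr rfl fun q hq => ?_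
      have := Finset.mem_range.1 hq
      congr 1
      omega
    refine ⟨fun i => Fintype.equivFinOfCardEq hcard ⟨k i, c (k i) i⟩, fun i j hij => ?_⟩
    have h := (Fintype.equivFinOfCardEq hcard).injective hij
    obtain ⟨h1, h2⟩ := Sigma.mk.inj h
    refine hcc (k j) i j h1 rfl ?_
    rw [h1] at h2
    exact eq_of_heq h2

theorem choose_mul_add_le (ρ s : ℕ) :
    (((ρ * s + s).choose s : ℕ) : ℝ) ≤ (((ρ : ℝ) + 1) * Real.exp 1) ^ s := by
  have h1 : (((ρ * s + s).choose s : ℕ) : ℝ) ≤ ((ρ * s + s : ℕ) : ℝ) ^ s / (s.factorial : ℝ) :=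
    Nat.choose_le_pow_div s _
  have h2 : (s : ℝ) ^ s / (s.factorial : ℝ) ≤ Real.exp s :=
    Real.pow_div_factorial_le_exp _ s.cast_nonneg s
  calc _ ≤ _ := h1
    _ = ((ρ : ℝ) + 1) ^ s * ((s : ℝ) ^ s / (s.factorial : ℝ)) := by
      push_cast
      rw [← mul_div_assoc, ← mul_pow]
      ring
    _ ≤ ((ρ : ℝ) + 1) ^ s * Real.exp s := by gcongr
    _ = _ := by rw [mul_pow, Real.exp_one_pow]

/-! ### Covering numbers, `L²` bounds and the entropy integral -/

/-- Centres must lie in the class, so each colour that occurs contributes one of its own members. -/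
theorem coveringNumber_goalClass_le {m d : ℕ} {Θ : Set (E m)} {G : E m → E d → ℝ} {η p : ℝ≥0∞}
    {Q : Measure (E d)} {κ : Type*} [Fintype κ] (c : Θ → κ)
    (h : ∀ θ θ' : Θ, c θ = c θ' → eLpNorm (G θ - G θ') p Q ≤ η) :
    coveringNumber η (goalClass Θ G) p Q ≤ (Fintype.card κ : ℕ∞) := by
  classical
  let C : Finset (E d → ℝ) := (Finset.univ : Finset (Set.range c)).image fun x => G x.2.choose
  have hC : C.card ≤ Fintype.card κ :=
    Finset.card_image_le.trans (Fintype.card_subtype_le _)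
  refine le_trans (iInf₂_le C ⟨?_, ?_⟩) (Nat.cast_le.2 hC)
  · intro g hg
    obtain ⟨x, -, rfl⟩ := Finset.mem_image.1 (Finset.mem_coe.1 hg)
    exact ⟨x.2.choose, x.2.choose.2, rfl⟩
  · rintro g ⟨θ, hθ, rfl⟩
    let x : Set.range c := ⟨c ⟨θ, hθ⟩, ⟨θ, hθ⟩, rfl⟩
    exact ⟨G x.2.choose, Finset.mem_image_of_mem _ (Finset.mem_univ x),
      h ⟨θ, hθ⟩ _ x.2.choose_spec.symm⟩

theorem sqrtLogTwoMul_le {N : ℕ∞} {n : ℕ} {x : ℝ} (h : N ≤ n) (hx : 0 ≤ x)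
    (hn : 2 * (n : ℝ) ≤ Real.exp x) : sqrtLogTwoMul N ≤ ENNReal.ofReal (Real.sqrt x) := by
  have hN : N ≠ ⊤ := ne_top_of_le_ne_top (ENat.natCast_ne_top n) h
  have hle : N.toNat ≤ n := ENat.toNat_le_of_le_natCast h
  rw [sqrtLogTwoMul, if_neg hN]
  refine ENNReal.ofReal_le_ofReal (Real.sqrt_le_sqrt ?_)
  -- An empty class has `N = 0`, where `Real.log 0 = 0`.
  rcases Nat.eq_zero_or_pos N.toNat with h0 | h0
  · simpa [h0] using hx
  · have : (0 : ℝ) < N.toNat := by exact_mod_cast h0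
    rw [Real.log_le_iff_le_exp (by positivity)]
    refine le_trans ?_ hn
    gcongr

/-- A bound on an `L²`-norm by splitting the space into a set where the function is small
and a set of small measure. -/
theorem eLpNorm_two_le_mul {Ω : Type*} [MeasurableSpace Ω] {Q : Measure Ω} {h ξ : Ω → ℝ}
    (hξ : Measurable ξ) {D : Set Ω} (hD : MeasurableSet D) {α β ε : ℝ} (hα : 0 ≤ α)
    (hβ : 0 ≤ β) (hε : 0 ≤ ε)
    (h1 : ∀ z ∉ D, |h z| ≤ α * |ξ z|) (h2 : ∀ z ∈ D, |h z| ≤ 2 * |ξ z|)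
    (hDβ : ∫⁻ z in D, ‖ξ z‖ₑ ^ 2 ∂Q ≤ ENNReal.ofReal β * ∫⁻ z, ‖ξ z‖ₑ ^ 2 ∂Q)
    (hsum : α ^ 2 + 4 * β ≤ ε ^ 2) :
    eLpNorm h 2 Q ≤ ENNReal.ofReal ε * eLpNorm ξ 2 Q := by
  have key : ∫⁻ z, ‖h z‖ₑ ^ 2 ∂Q ≤ ENNReal.ofReal ε ^ 2 * ∫⁻ z, ‖ξ z‖ₑ ^ 2 ∂Q := by
    have hpt : ∀ z, ‖h z‖ₑ ^ 2 ≤ ENNReal.ofReal α ^ 2 * ‖ξ z‖ₑ ^ 2 +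
        4 * D.indicator (fun z => ‖ξ z‖ₑ ^ 2) z := by
      intro z
      have e : ∀ a : ℝ, 0 ≤ a → |h z| ≤ a * |ξ z| → ‖h z‖ₑ ≤ ENNReal.ofReal a * ‖ξ z‖ₑ := by
        intro a ha hh
        rw [Real.enorm_eq_ofReal_abs, Real.enorm_eq_ofReal_abs, ← ENNReal.ofReal_mul ha]
        exact ENNReal.ofReal_le_ofReal hh
      by_cases hz : z ∈ D
      · rw [Set.indicator_of_mem hz]
        refine le_add_left ?_
        have := pow_le_pow_left₀ (zero_le) (e 2 (by norm_num) (h2 z hz)) 2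
        rw [mul_pow] at this
        refine this.trans_eq ?_
        congr 1
        norm_num
      · have := pow_le_pow_left₀ (zero_le) (e α hα (h1 z hz)) 2
        rw [mul_pow] at this
        exact le_add_right this
    calc _ ≤ ∫⁻ z, (ENNReal.ofReal α ^ 2 * ‖ξ z‖ₑ ^ 2 +
          4 * D.indicator (fun z => ‖ξ z‖ₑ ^ 2) z) ∂Q := lintegral_mono hpt
      _ = ENNReal.ofReal α ^ 2 * ∫⁻ z, ‖ξ z‖ₑ ^ 2 ∂Q + 4 * ∫⁻ z in D, ‖ξ z‖ₑ ^ 2 ∂Q := by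
        have hm : Measurable fun z => ‖ξ z‖ₑ ^ 2 := by fun_prop
        rw [lintegral_add_left (by fun_prop), lintegral_const_mul _ hm,
          lintegral_const_mul _ (hm.indicator hD), lintegral_indicator hD]
      _ ≤ ENNReal.ofReal α ^ 2 * ∫⁻ z, ‖ξ z‖ₑ ^ 2 ∂Q +
          4 * (ENNReal.ofReal β * ∫⁻ z, ‖ξ z‖ₑ ^ 2 ∂Q) := by gcongr
      _ = ENNReal.ofReal (α ^ 2 + 4 * β) * ∫⁻ z, ‖ξ z‖ₑ ^ 2 ∂Q := by
        rw [ENNReal.ofReal_add (by positivity) (by positivity), ENNReal.ofReal_mul (by norm_num),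
          ENNReal.ofReal_pow hα, ENNReal.ofReal_ofNat]
        ring
      _ ≤ _ := by
        rw [← ENNReal.ofReal_pow hε]
        gcongr
  rw [eLpNorm_eq_lintegral_rpow_enorm_toReal (by norm_num) (by norm_num),
    eLpNorm_eq_lintegral_rpow_enorm_toReal (by norm_num) (by norm_num)]
  simp only [ENNReal.toReal_ofNat, ENNReal.rpow_ofNat]
  calc _ ≤ (ENNReal.ofReal ε ^ 2 * ∫⁻ z, ‖ξ z‖ₑ ^ 2 ∂Q) ^ (1 / 2 : ℝ) := by gcongr
    _ = _ := by
      rw [ENNReal.mul_rpow_of_nonneg _ _ (by norm_num), ← ENNReal.rpow_natCast, ← ENNReal.rpow_mul]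
      norm_num

/-- By AM-GM, `√y ≤ (y/c + c)/2` for `c > 0`. The mean of `-ln ε` over `]0, δ]` is `1 - ln δ`,
whence the extra `B`; with `c = 2√X` the mean of the majorant is at most `c`. -/
theorem lintegral_sqrt_sub_mul_log_le {A B δ X : ℝ} (hδ : 0 < δ) (hδ1 : δ ≤ 1) (hA : 0 ≤ A)
    (hB : 0 ≤ B) (hX : 0 < X) (h : A + B - B * Real.log δ ≤ 4 * X) :
    ∫⁻ ε in Set.Ioc 0 δ, ENNReal.ofReal (Real.sqrt (A - B * Real.log ε)) ≤
      ENNReal.ofReal (2 * δ * Real.sqrt X) := by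
  set c := 2 * Real.sqrt X with hc
  have hc0 : 0 < c := by positivity
  have hc2 : c ^ 2 = 4 * X := by rw [hc, mul_pow, Real.sq_sqrt hX.le]; norm_num
  have hnn : ∀ ε ∈ Set.Ioc 0 δ, 0 ≤ A - B * Real.log ε := fun ε hε => by
    have := mul_nonneg hB (neg_nonneg.2 (Real.log_nonpos hε.1.le (hε.2.trans hδ1)))
    linarith
  have hlog : IntervalIntegrable (fun ε => B * Real.log ε) volume 0 δ :=
    intervalIntegral.intervalIntegrable_log'.const_mul B
  have hi : IntervalIntegrable (fun ε => ((A - B * Real.log ε) / c + c) / 2) volume 0 δ :=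
    (((intervalIntegrable_const.sub hlog).div_const c).add intervalIntegrable_const).div_const 2
  have hint : ∫ ε in (0 : ℝ)..δ, ((A - B * Real.log ε) / c + c) / 2 =
      ((A + B - B * Real.log δ) / c + c) / 2 * δ := by
    rw [intervalIntegral.integral_div, intervalIntegral.integral_add
      ((intervalIntegrable_const.sub hlog).div_const c) intervalIntegrable_const,
      intervalIntegral.integral_div, intervalIntegral.integral_sub intervalIntegrable_const hlog,
      intervalIntegral.integral_const_mul, integral_log]
    simp only [intervalIntegral.integral_const, smul_eq_mul]
    simp
    field_simp
    ring
  calc _ ≤ ∫⁻ ε in Set.Ioc 0 δ, ENNReal.ofReal (((A - B * Real.log ε) / c + c) / 2) := by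
        refine setLIntegral_mono' measurableSet_Ioc fun ε hε => ENNReal.ofReal_le_ofReal ?_
        set y := Real.sqrt (A - B * Real.log ε) with hy
        have hy2 : y ^ 2 = A - B * Real.log ε := Real.sq_sqrt (hnn ε hε)
        rw [← hy2]
        have : (y ^ 2 / c + c) / 2 - y = (y - c) ^ 2 / (2 * c) := by field_simp; ring
        have h2 : 0 ≤ (y - c) ^ 2 / (2 * c) := by positivity
        linarith
    _ = ENNReal.ofReal (∫ ε in (0 : ℝ)..δ, ((A - B * Real.log ε) / c + c) / 2) := by
        rw [intervalIntegral.integral_of_le hδ.le, ofReal_integral_eq_lintegral_ofReal]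
        · exact (intervalIntegrable_iff_integrableOn_Ioc_of_le hδ.le).1 hi
        · filter_upwards [ae_restrict_mem measurableSet_Ioc] with ε hε
          have := hnn ε hε
          simp only [Pi.zero_apply]
          positivity
    _ ≤ _ := by
        refine ENNReal.ofReal_le_ofReal ?_
        rw [hint]
        have h1 : (A + B - B * Real.log δ) / c ≤ c := by
          rw [div_le_iff₀ hc0, ← sq, hc2]
          exact h
        calc _ ≤ (c + c) / 2 * δ := by gcongr
          _ = _ := by rw [hc]; ring

/-! ### Half-spaces, cells and measurability -/

namespace PLData

variable {m d : ℕ} (D : PLData m d)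

/-- The set `{z | L^i_l(T θ + z) + a^i_l ∈ I_{il}}`. -/
def halfSpace (i : Fin D.r) (l : Fin (D.s i)) (θ : E m) : Set (E d) :=
  {z | D.L i l (D.T θ + z) + D.a i l ∈ D.I i l}

/-- The set on which `f^i(θ, ·)` is one. -/
def cell (i : Fin D.r) (θ : E m) : Set (E d) :=
  ⋂ l, D.halfSpace i l θ

theorem measurableSet_I (i : Fin D.r) (l : Fin (D.s i)) : MeasurableSet (D.I i l) := by
  have h : D.I i l = Set.Ioi 0 ∪ (D.I i l ∩ {0}) := by
    ext x
    refine ⟨fun hx => ?_, fun hx => hx.elim (fun h => D.Ioi_subset i l h) fun h => h.1⟩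
    exact (Set.mem_Ici.1 (D.subset_Ici i l hx)).lt_or_eq.imp id fun h => ⟨hx, h.symm⟩
  rw [h]
  exact measurableSet_Ioi.union ((Set.finite_singleton _).inter_of_right _).measurableSet

theorem isUpperSet_I (i : Fin D.r) (l : Fin (D.s i)) : IsUpperSet (D.I i l) := by
  intro x y hxy hx
  rcases hxy.lt_or_eq with h | h
  · exact D.Ioi_subset i l ((Set.mem_Ici.1 (D.subset_Ici i l hx)).trans_lt h)
  · exact h ▸ hx

theorem measurableSet_halfSpace (i : Fin D.r) (l : Fin (D.s i)) (θ : E m) :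
    MeasurableSet (D.halfSpace i l θ) := by
  have h : Continuous fun z => D.L i l (D.T θ + z) + D.a i l :=
    ((D.L i l).continuous_of_finiteDimensional.comp (continuous_const.add continuous_id)).add
      continuous_const
  exact h.measurable (D.measurableSet_I i l)

theorem measurableSet_cell (i : Fin D.r) (θ : E m) : MeasurableSet (D.cell i θ) :=
  MeasurableSet.iInter fun l => D.measurableSet_halfSpace i l θ

/-- The parameter enters only through the number `L^i_l(T θ)`, and `I_{il}` is an upper set. -/
theorem halfSpace_total (i : Fin D.r) (l : Fin (D.s i)) (θ θ' : E m) :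
    D.halfSpace i l θ ⊆ D.halfSpace i l θ' ∨ D.halfSpace i l θ' ⊆ D.halfSpace i l θ := by
  have aux : ∀ θ θ', D.L i l (D.T θ) ≤ D.L i l (D.T θ') →
      D.halfSpace i l θ ⊆ D.halfSpace i l θ' := by
    intro θ θ' h z hz
    refine D.isUpperSet_I i l ?_ hz
    simp only [map_add]
    linarith
  exact (le_total (D.L i l (D.T θ)) (D.L i l (D.T θ'))).imp (aux _ _) (aux _ _)

theorem f_eq_indicator (i : Fin D.r) (θ : E m) :
    D.f i θ = (D.cell i θ).indicator fun _ => 1 := by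
  funext z
  have : Nonempty (Fin (D.s i)) := ⟨⟨0, D.s_pos i⟩⟩
  rw [f]
  by_cases hz : z ∈ D.cell i θ
  · rw [Set.indicator_of_mem hz]
    have h : ∀ l, (D.I i l).indicator (fun _ => (1 : ℝ)) (D.L i l (D.T θ + z) + D.a i l) = 1 :=
      fun l => Set.indicator_of_mem (show _ ∈ D.I i l from Set.mem_iInter.1 hz l) _
    simp only [h, ciInf_const]
  · rw [Set.indicator_of_notMem hz]
    obtain ⟨l, hl⟩ : ∃ l, z ∉ D.halfSpace i l θ := by simpa [cell] using hz
    refine le_antisymm ?_ (le_ciInf fun l => Set.indicator_nonneg (fun _ _ => zero_le_one) _)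
    exact (ciInf_le (Set.finite_range _).bddBelow l).trans_eq
      (Set.indicator_of_notMem (show _ ∉ D.I i l from hl) _)

theorem f_nonneg (i : Fin D.r) (θ : E m) (z : E d) : 0 ≤ D.f i θ z := by
  rw [f_eq_indicator]
  exact Set.indicator_nonneg (fun _ _ => zero_le_one) _

theorem measurable_f (i : Fin D.r) (θ : E m) : Measurable (D.f i θ) := by
  rw [f_eq_indicator]
  exact measurable_const.indicator (D.measurableSet_cell i θ)

theorem measurable_Gpart (i : Fin D.r) (θ : E m) : Measurable (D.Gpart i θ) :=
  (((D.Λ i).continuous_of_finiteDimensional.comp (continuous_const.add continuous_id)).add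
    continuous_const).measurable

theorem measurable_Λ (i : Fin D.r) : Measurable (D.Λ i) :=
  (D.Λ i).continuous_of_finiteDimensional.measurable

theorem condA1 {Θ : Set (E m)} {G : E m → E d → ℝ} (h : D.Represents Θ G) : CondA1 Θ G := by
  intro θ hθ
  rw [funext (h.eq_sum θ hθ)]
  exact Finset.measurable_sum _ fun i _ => (D.measurable_f i θ).mul (D.measurable_Gpart i θ)

/-- The constant term `Λ_i(T θ) + b_i` of `G^i(θ, ·)`. -/
def shift (i : Fin D.r) (θ : E m) : ℝ :=
  D.Λ i (D.T θ) + D.b i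

theorem Gpart_eq (i : Fin D.r) (θ : E m) (z : E d) :
    D.Gpart i θ z = D.Λ i z + D.shift i θ := by
  rw [Gpart, shift, map_add]
  ring

theorem supConst_nonneg (Θ : Set (E m)) (i : Fin D.r) : 0 ≤ D.supConst Θ i :=
  Real.sSup_nonneg (by rintro _ ⟨θ, -, rfl⟩; exact abs_nonneg _)

theorem supConst_le_etaG (Θ : Set (E m)) (i : Fin D.r) : D.supConst Θ i ≤ D.etaG Θ i :=
  le_add_of_nonneg_right (Set.indicator_nonneg (fun _ _ => zero_le_one) _)

/-- This is the purpose of the indicator in `η_i^G`: it keeps the envelope positive and the grid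
width nonzero when the supremum vanishes. -/
theorem etaG_pos (Θ : Set (E m)) (i : Fin D.r) : 0 < D.etaG Θ i := by
  rcases (D.supConst_nonneg Θ i).lt_or_eq with h | h
  · exact h.trans_le (D.supConst_le_etaG Θ i)
  · simp [etaG, ← h]

theorem abs_shift_le {Θ : Set (E m)} (hΘ : IsCompact Θ) (i : Fin D.r) {θ : E m} (hθ : θ ∈ Θ) :
    |D.shift i θ| ≤ D.etaG Θ i := by
  refine le_trans ?_ (D.supConst_le_etaG Θ i)
  have hc : Continuous fun θ => |D.Λ i (D.T θ) + D.b i| :=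
    (((D.Λ i).continuous_of_finiteDimensional.comp
      D.T.continuous_of_finiteDimensional).add continuous_const).abs
  exact le_csSup (hΘ.bddAbove_image hc.continuousOn) ⟨θ, hθ, rfl⟩

/-! ### The envelope `ξ` -/

section Envelope

variable {Θ : Set (E m)} {G : E m → E d → ℝ} {ξ : Fin D.r → E d → ℝ}

theorem f_le (hξ : ∀ i, IsPositiveEnvelope (goalClass Θ (D.f i)) (ξ i)) (i : Fin D.r) {θ : E m}
    (hθ : θ ∈ Θ) (z : E d) : D.f i θ z ≤ ξ i z :=
  (le_abs_self _).trans ((hξ i).1.2 _ ⟨θ, hθ, rfl⟩ z)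

theorem envelope_pos (hξ : ∀ i z, 0 < ξ i z) (z : E d) : 0 < D.envelope Θ ξ z := by
  refine Finset.sum_pos (fun i _ => mul_pos (hξ i z) ?_) ⟨⟨0, D.r_pos⟩, Finset.mem_univ _⟩
  exact add_pos_of_nonneg_of_pos (abs_nonneg _) (D.etaG_pos Θ i)

theorem measurable_envelope (hξ : ∀ i, Measurable (ξ i)) : Measurable (D.envelope Θ ξ) :=
  Finset.measurable_sum _ fun i _ => (hξ i).mul ((D.measurable_Λ i).abs.add_const _)

theorem abs_le_envelope (hΘ : IsCompact Θ) (hPL : D.Represents Θ G)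
    (hξ : ∀ i, IsPositiveEnvelope (goalClass Θ (D.f i)) (ξ i)) {θ : E m} (hθ : θ ∈ Θ) (z : E d) :
    |G θ z| ≤ D.envelope Θ ξ z := by
  rw [hPL.eq_sum θ hθ z]
  refine (Finset.abs_sum_le_sum_abs _ _).trans (Finset.sum_le_sum fun i _ => ?_)
  rw [abs_mul, abs_of_nonneg (D.f_nonneg i θ z), Gpart_eq]
  refine mul_le_mul (D.f_le hξ i hθ z) ?_ (abs_nonneg _) ((hξ i).2 z).le
  exact (abs_add_le _ _).trans (add_le_add_right (D.abs_shift_le hΘ i hθ) _)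

/-- Where no indicator changes, the terms `Λ_i z` cancel and only the constants differ. -/
theorem abs_sub_le_of_cell_eq (hPL : D.Represents Θ G)
    (hξ : ∀ i, IsPositiveEnvelope (goalClass Θ (D.f i)) (ξ i)) {θ θ' : E m} (hθ : θ ∈ Θ)
    (hθ' : θ' ∈ Θ) {α : ℝ} (hα : 0 ≤ α)
    (hs : ∀ i, |D.shift i θ - D.shift i θ'| ≤ α * D.etaG Θ i) {z : E d}
    (hz : ∀ i, D.f i θ z = D.f i θ' z) : |G θ z - G θ' z| ≤ α * D.envelope Θ ξ z := by
  rw [hPL.eq_sum θ hθ z, hPL.eq_sum θ' hθ' z, ← Finset.sum_sub_distrib, envelope, Finset.mul_sum]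
  refine (Finset.abs_sum_le_sum_abs _ _).trans (Finset.sum_le_sum fun i _ => ?_)
  rw [← hz i, ← mul_sub, Gpart_eq, Gpart_eq, add_sub_add_left_eq_sub, abs_mul,
    abs_of_nonneg (D.f_nonneg i θ z), mul_left_comm]
  refine mul_le_mul (D.f_le hξ i hθ z) ((hs i).trans ?_) (abs_nonneg _) ((hξ i).2 z).le
  exact mul_le_mul_of_nonneg_left (le_add_of_nonneg_left (abs_nonneg _)) hα

theorem memLp_envelope {μ : Measure (E d)} (hΛ : ∀ i, MemLp (fun z => D.Λ i z) 2 μ)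
    [IsFiniteMeasure μ] (hξm : ∀ i, Measurable (ξ i)) (hξ0 : ∀ i z, 0 < ξ i z)
    (hξ : ∀ i, ∃ M : ℝ, ∀ z, ξ i z ≤ M) : MemLp (D.envelope Θ ξ) 2 μ := by
  refine memLp_finsetSum _ fun i _ => ?_
  obtain ⟨M, hM⟩ := hξ i
  refine (((hΛ i).abs.add (memLp_const (D.etaG Θ i))).const_mul M).of_le
    ((hξm i).mul ((D.measurable_Λ i).abs.add_const _)).aestronglyMeasurable
    (Filter.Eventually.of_forall fun z => ?_)
  have h := add_pos_of_nonneg_of_pos (abs_nonneg (D.Λ i z)) (D.etaG_pos Θ i)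
  have h1 := hξ0 i z
  simp only [Pi.add_apply, Pi.abs_apply]
  rw [norm_mul, norm_mul, Real.norm_of_nonneg h1.le, Real.norm_of_nonneg (h1.le.trans (hM z))]
  exact mul_le_mul_of_nonneg_right (hM z) (norm_nonneg _)

end Envelope

end PLData

theorem memLp_of_mem_finSuppProb {d : ℕ} {Q : Measure (E d)} (hQ : Q ∈ finSuppProb d)
    {ξ : E d → ℝ} (hξ : Measurable ξ) (p : ℝ≥0∞) : MemLp ξ p Q := by
  obtain ⟨_, S, hS⟩ := hQ
  refine MemLp.of_bound hξ.aestronglyMeasurable (∑ z ∈ S, ‖ξ z‖) ?_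
  filter_upwards [mem_ae_iff.2 hS] with z hzS
  exact Finset.single_le_sum (f := fun z => ‖ξ z‖) (fun _ _ => norm_nonneg _) hzS

/-- Bounded reals can be coloured with few colours such that numbers of equal colour are close. -/
theorem exists_colouring_of_abs_le {ι : Type*} (x : ι → ℝ) {η α : ℝ} (hη : 0 < η) (hα : 0 < α)
    (hx : ∀ i, |x i| ≤ η) :
    ∃ c : ι → Fin (⌊2 / α⌋₊ + 1), ∀ i j, c i = c j → |x i - x j| ≤ α * η := by
  have hnn : ∀ i, 0 ≤ (x i + η) / (α * η) := fun i =>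
    div_nonneg (by linarith [(abs_le.1 (hx i)).1]) (by positivity)
  have hle : ∀ i, (x i + η) / (α * η) ≤ 2 / α := fun i => by
    rw [div_le_div_iff₀ (by positivity) hα]
    nlinarith [(abs_le.1 (hx i)).2]
  refine ⟨fun i => ⟨⌊(x i + η) / (α * η)⌋₊, Nat.lt_succ_of_le (Nat.floor_mono (hle i))⟩,
    fun i j hij => ?_⟩
  have h0 : ⌊(x i + η) / (α * η)⌋₊ = ⌊(x j + η) / (α * η)⌋₊ := congrArg Fin.val hij
  have hp : 0 < α * η := by positivity
  have h1 := Nat.lt_floor_add_one ((x i + η) / (α * η))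
  have h2 := Nat.floor_le (hnn i)
  have h3 := Nat.lt_floor_add_one ((x j + η) / (α * η))
  have h4 := Nat.floor_le (hnn j)
  rw [h0] at h1 h2
  rw [div_lt_iff₀ hp] at h1 h3
  rw [le_div_iff₀ hp] at h2 h4
  rw [abs_le]
  constructor <;> linarith

/-! ### Covering numbers of the goal class -/

namespace PLData

variable {m d : ℕ} (D : PLData m d) {Θ : Set (E m)} {G : E m → E d → ℝ} {ξ : Fin D.r → E d → ℝ}

theorem coveringNumber_le (hΘ : IsCompact Θ) (hPL : D.Represents Θ G)
    (hξ : ∀ i, IsPositiveEnvelope (goalClass Θ (D.f i)) (ξ i)) {Q : Measure (E d)}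
    (hQ : Q ∈ finSuppProb d) {ε : ℝ} (hε : 0 < ε) {ρ : ℕ} (hρ : 16 * (D.r : ℝ) ≤ ρ * ε ^ 2) :
    coveringNumber (ENNReal.ofReal ε * eLpNorm (D.envelope Θ ξ) 2 Q) (goalClass Θ G) 2 Q ≤
      ((∏ i, (ρ * D.s i + D.s i).choose (D.s i) * (⌊2 / (ε / 2)⌋₊ + 1) : ℕ) : ℕ∞) := by
  have := hQ.1
  have hr : (1 : ℝ) ≤ D.r := by exact_mod_cast D.r_pos
  have hρ0 : (0 : ℝ) < ρ := by
    by_contra hcon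
    have h0 : (ρ : ℝ) = 0 := le_antisymm (not_lt.1 hcon) ρ.cast_nonneg
    rw [h0] at hρ
    linarith
  set w := D.envelope Θ ξ with hw
  have hwpos : ∀ z, 0 < w z := D.envelope_pos fun i => (hξ i).2
  have hwm : Measurable w := D.measurable_envelope fun i => (hξ i).1.1
  have hm2 : Measurable fun z => ‖w z‖ₑ ^ 2 := by fun_prop
  -- Under this weight, the squared `L²(Q)`-norm of the envelope over a set becomes the mass of the
  -- set.
  let ν := Q.withDensity fun z => ‖w z‖ₑ ^ 2
  have hν : ν Set.univ = ∫⁻ z, ‖w z‖ₑ ^ 2 ∂Q := by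
    rw [withDensity_apply _ MeasurableSet.univ, Measure.restrict_univ]
  have hfin : IsFiniteMeasure ν := by
    refine isFiniteMeasure_withDensity ?_
    have := (memLp_of_mem_finSuppProb hQ hwm 2).eLpNorm_lt_top
    have h2 := lintegral_rpow_enorm_lt_top_of_eLpNorm_lt_top (by norm_num) (by norm_num) this
    simpa using h2.ne
  have hM : 0 < ν.real Set.univ := by
    rw [measureReal_def, ENNReal.toReal_pos_iff]
    refine ⟨?_, measure_lt_top _ _⟩
    rw [hν, lintegral_pos_iff_support hm2]
    have : Function.support (fun z => ‖w z‖ₑ ^ 2) = Set.univ := by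
      ext z
      simp [(hwpos z).ne']
    rw [this]
    simp
  set M := ν.real Set.univ with hMdef
  have hη : 0 < M / ρ := by positivity
  have hcell : ∀ i, ∃ c : Θ → Fin ((ρ * D.s i + D.s i).choose (D.s i)), ∀ θ θ', c θ = c θ' →
      ν.real (symmDiff (D.cell i θ) (D.cell i θ')) ≤ 2 * M / ρ := by
    intro i
    have hs : (0 : ℝ) < D.s i := by exact_mod_cast D.s_pos i
    -- Dividing by `s_i` makes the error `2 s_i η` equal to `2M/ρ` for every `i`; `K = ρ s_i` then
    -- gives `(K + 1) η > M`.
    have hη' : 0 < M / ρ / D.s i := by positivity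
    obtain ⟨c, hc⟩ := exists_colouring_iInter_chains hη' (D.s i) (ρ * D.s i) ν
      (fun l (θ : Θ) => D.halfSpace i l θ) (fun l θ => D.measurableSet_halfSpace i l θ)
      (fun l θ θ' => D.halfSpace_total i l θ θ') (by
        have : ((ρ * D.s i : ℕ) + 1 : ℝ) * (M / ρ / D.s i) = M + M / ρ / D.s i := by
          push_cast
          field_simp
        rw [this]
        linarith)
    refine ⟨c, fun θ θ' h => (hc θ θ' h).trans_eq ?_⟩
    field_simp
  have hshift : ∀ i, ∃ c : Θ → Fin (⌊2 / (ε / 2)⌋₊ + 1), ∀ θ θ' : Θ, c θ = c θ' →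
      |D.shift i θ - D.shift i θ'| ≤ ε / 2 * D.etaG Θ i := fun i =>
    exists_colouring_of_abs_le (fun θ : Θ => D.shift i θ) (D.etaG_pos Θ i) (by positivity)
      fun θ => D.abs_shift_le hΘ i θ.2
  choose c₁ hc₁ using hcell
  choose c₂ hc₂ using hshift
  have hcard : Fintype.card
      ((i : Fin D.r) → Fin ((ρ * D.s i + D.s i).choose (D.s i)) × Fin (⌊2 / (ε / 2)⌋₊ + 1)) =
      ∏ i, (ρ * D.s i + D.s i).choose (D.s i) * (⌊2 / (ε / 2)⌋₊ + 1) := by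
    simp
  rw [← hcard]
  refine coveringNumber_goalClass_le (fun θ i => (c₁ i θ, c₂ i θ)) fun θ θ' h => ?_
  have h1 : ∀ i, c₁ i θ = c₁ i θ' := fun i => congrArg Prod.fst (congrFun h i)
  have h2 : ∀ i, c₂ i θ = c₂ i θ' := fun i => congrArg Prod.snd (congrFun h i)
  set B : Set (E d) := ⋃ i, symmDiff (D.cell i θ) (D.cell i θ') with hB
  have hBm : MeasurableSet B := MeasurableSet.iUnion fun i =>
    (D.measurableSet_cell i θ).symmDiff (D.measurableSet_cell i θ')
  have hνB : ν.real B ≤ D.r * (2 / ρ) * M := by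
    refine (measureReal_iUnion_fintype_le _).trans ?_
    refine (Finset.sum_le_sum fun i _ => hc₁ i θ θ' (h1 i)).trans_eq ?_
    simp
    ring
  refine eLpNorm_two_le_mul hwm hBm (α := ε / 2) (β := D.r * (2 / ρ)) (by positivity)
    (by positivity) hε.le ?_ ?_ ?_ ?_
  · intro z hz
    rw [abs_of_pos (hwpos z)]
    refine D.abs_sub_le_of_cell_eq hPL hξ θ.2 θ'.2 (by positivity)
      (fun i => hc₂ i θ θ' (h2 i)) fun i => ?_
    have hzi : z ∉ symmDiff (D.cell i θ) (D.cell i θ') := fun hh => hz (Set.mem_iUnion.2 ⟨i, hh⟩)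
    have hiff : z ∈ D.cell i θ ↔ z ∈ D.cell i θ' := by
      rw [Set.mem_symmDiff] at hzi
      tauto
    rw [f_eq_indicator, f_eq_indicator]
    by_cases hh : z ∈ D.cell i θ
    · rw [Set.indicator_of_mem hh, Set.indicator_of_mem (hiff.1 hh)]
    · rw [Set.indicator_of_notMem hh, Set.indicator_of_notMem fun h' => hh (hiff.2 h')]
  · intro z _
    rw [abs_of_pos (hwpos z)]
    have e1 := D.abs_le_envelope hΘ hPL hξ θ.2 z
    have e2 := D.abs_le_envelope hΘ hPL hξ θ'.2 z
    have := abs_sub (G θ z) (G θ' z)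
    simp only [Pi.sub_apply]
    linarith
  · rw [← withDensity_apply _ hBm, ← hν]
    change ν B ≤ _
    rw [← ENNReal.ofReal_toReal (measure_ne_top ν B),
      ← ENNReal.ofReal_toReal (measure_ne_top ν Set.univ), ← ENNReal.ofReal_mul (by positivity)]
    exact ENNReal.ofReal_le_ofReal hνB
  -- The budget is `ε²/4` off `B` and `4 · 2r/ρ ≤ ε²/2` on `B`.
  · have : (D.r : ℝ) * (2 / ρ) ≤ ε ^ 2 / 8 := by
      rw [mul_div_assoc', div_le_div_iff₀ hρ0 (by norm_num)]
      linarith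
    nlinarith

/-- Each half-space costs a factor `(ρ + 1) e ≤ 54 r/ε² ≤ 2⁶ r/ε²`, each constant a factor `4/ε + 1
≤ 2³/ε`. -/
theorem two_mul_prod_choose_le {ε : ℝ} (hε : 0 < ε) (hε1 : ε ≤ 1) :
    2 * ((∏ i, (⌈16 * (D.r : ℝ) / ε ^ 2⌉₊ * D.s i + D.s i).choose (D.s i) *
        (⌊2 / (ε / 2)⌋₊ + 1) : ℕ) : ℝ) ≤
      Real.exp ((1 + 6 * (∑ i, (D.s i : ℝ)) + 3 * D.r) * Real.log 2 +
        (∑ i, (D.s i : ℝ)) * Real.log D.r -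
        (2 * (∑ i, (D.s i : ℝ)) + D.r) * Real.log ε) := by
  have hr : (1 : ℝ) ≤ D.r := by exact_mod_cast D.r_pos
  have hr0 : (0 : ℝ) < D.r := by linarith
  have hε2 : ε ^ 2 ≤ 1 := pow_le_one₀ hε.le hε1
  have h1 : ((⌈16 * (D.r : ℝ) / ε ^ 2⌉₊ : ℝ) + 1) * Real.exp 1 ≤ 2 ^ 6 * D.r / ε ^ 2 := by
    have e1 := (Nat.ceil_lt_add_one (a := 16 * (D.r : ℝ) / ε ^ 2) (by positivity)).le
    have e2 : (1 : ℝ) ≤ D.r / ε ^ 2 := by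
      rw [le_div_iff₀ (by positivity)]
      linarith
    have e3 : (⌈16 * (D.r : ℝ) / ε ^ 2⌉₊ : ℝ) + 1 ≤ 18 * (D.r / ε ^ 2) := by
      rw [mul_div_assoc] at e1 ⊢
      linarith
    have e4 : Real.exp 1 ≤ 3 := Real.exp_one_lt_three.le
    calc _ ≤ 18 * (D.r / ε ^ 2) * 3 := by gcongr
      _ = 54 * (D.r / ε ^ 2) := by ring
      _ ≤ 2 ^ 6 * (D.r / ε ^ 2) := by gcongr; norm_num
      _ = _ := by ring
  have h2 : ((⌊2 / (ε / 2)⌋₊ : ℝ) + 1) ≤ 2 ^ 3 / ε := by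
    have e1 := Nat.floor_le (a := 2 / (ε / 2)) (by positivity)
    have e2 : (1 : ℝ) ≤ 1 / ε := by
      rw [le_div_iff₀ hε]
      linarith
    have e3 : 2 / (ε / 2) = 4 * (1 / ε) := by field_simp; norm_num
    have e4 : 2 ^ 3 / ε = 8 * (1 / ε) := by ring
    linarith
  have l1 : Real.exp (6 * Real.log 2 + Real.log D.r - 2 * Real.log ε) = 2 ^ 6 * D.r / ε ^ 2 := by
    rw [Real.exp_sub, Real.exp_add, Real.exp_log hr0]
    have e1 : ∀ x : ℝ, 0 < x → ∀ n : ℕ, Real.exp (n * Real.log x) = x ^ n := fun x hx n => by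
      rw [Real.exp_nat_mul, Real.exp_log hx]
    have e2 := e1 2 (by norm_num) 6
    have e3 := e1 ε hε 2
    push_cast at e2 e3
    rw [e2, e3]
  have l2 : Real.exp (3 * Real.log 2 - Real.log ε) = 2 ^ 3 / ε := by
    rw [Real.exp_sub, Real.exp_log hε]
    have := Real.exp_nat_mul (Real.log 2) 3
    push_cast at this
    rw [this, Real.exp_log (by norm_num)]
  rw [← l1] at h1
  rw [← l2] at h2
  push_cast
  calc _ ≤ 2 * ∏ i, (Real.exp (6 * Real.log 2 + Real.log D.r - 2 * Real.log ε) ^ D.s i *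
        Real.exp (3 * Real.log 2 - Real.log ε)) := by
        gcongr with i
        exact (choose_mul_add_le _ _).trans (by gcongr)
    _ = Real.exp (Real.log 2) * Real.exp (∑ i, (D.s i * (6 * Real.log 2 + Real.log D.r -
        2 * Real.log ε) + (3 * Real.log 2 - Real.log ε))) := by
        rw [Real.exp_log (by norm_num), Real.exp_sum]
        simp only [Real.exp_add _ (3 * Real.log 2 - Real.log ε), Real.exp_nat_mul]
    _ = _ := by
        rw [← Real.exp_add, Finset.sum_add_distrib, ← Finset.sum_mul]
        simp only [Finset.sum_const, Finset.card_univ, Fintype.card_fin, nsmul_eq_mul]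
        congr 1
        ring

theorem entropyIntegral_goalClass_le (hΘ : IsCompact Θ) (hPL : D.Represents Θ G)
    (hξ : ∀ i, IsPositiveEnvelope (goalClass Θ (D.f i)) (ξ i)) {δ : ℝ} (hδ : 0 < δ)
    (hδ1 : δ ≤ 1) :
    entropyIntegral (goalClass Θ G) (D.envelope Θ ξ) δ ≤
      ENNReal.ofReal (2 * δ * Real.sqrt
        ((∑ i, Real.log ((D.s i : ℝ) + 1))
          + (8 * (∑ i, (D.s i : ℝ)) + 30 * (D.r : ℝ) + 1) * Real.log 2
          + 2 * ((∑ i, (D.s i : ℝ)) + 3 * (D.r : ℝ)) *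
              (1 / 2 + Real.log ((D.r : ℝ) / δ)))) := by
  have hr : (1 : ℝ) ≤ D.r := by exact_mod_cast D.r_pos
  have hlr : 0 ≤ Real.log D.r := Real.log_nonneg hr
  have hl2 : 0 < Real.log 2 := Real.log_pos (by norm_num)
  have hlδ : 0 ≤ -Real.log δ := neg_nonneg.2 (Real.log_nonpos hδ.le hδ1)
  have hσ : 0 ≤ ∑ i, (D.s i : ℝ) := Finset.sum_nonneg fun i _ => Nat.cast_nonneg _
  have hls : 0 ≤ ∑ i, Real.log ((D.s i : ℝ) + 1) := Finset.sum_nonneg fun i _ =>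
    Real.log_nonneg (by linarith [(Nat.cast_nonneg (D.s i) : (0 : ℝ) ≤ _)])
  rw [Real.log_div (by linarith) hδ.ne']
  set σ := ∑ i, (D.s i : ℝ) with hσdef
  have n1 : 0 ≤ σ * Real.log 2 := by positivity
  have n2 : 0 ≤ D.r * Real.log 2 := by positivity
  have n3 : 0 ≤ σ * Real.log D.r := by positivity
  have n4 : 0 ≤ D.r * Real.log D.r := by positivity
  have n5 : 0 ≤ σ * -Real.log δ := by positivity
  have n6 : 0 ≤ D.r * -Real.log δ := by positivity
  have hA : 0 ≤ (1 + 6 * σ + 3 * D.r) * Real.log 2 + σ * Real.log D.r := by positivity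
  -- Here `A + B - B ln δ ≤ 4X` holds with room to spare: each of its terms is dominated by a term
  -- of `4X`.
  refine le_trans ?_ (lintegral_sqrt_sub_mul_log_le (B := 2 * σ + D.r) hδ hδ1 hA (by positivity)
    (by nlinarith) (by nlinarith))
  refine setLIntegral_mono' measurableSet_Ioc fun ε hε => iSup₂_le fun Q hQ => ?_
  have hε1 : ε ≤ 1 := hε.2.trans hδ1
  have hlε : 0 ≤ -Real.log ε := neg_nonneg.2 (Real.log_nonpos hε.1.le hε1)
  have n7 : 0 ≤ (2 * σ + D.r) * -Real.log ε := by positivity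
  refine sqrtLogTwoMul_le (D.coveringNumber_le hΘ hPL hξ hQ hε.1
    (ρ := ⌈16 * (D.r : ℝ) / ε ^ 2⌉₊) ?_) (by linarith)
    (D.two_mul_prod_choose_le hε.1 hε1)
  have := Nat.le_ceil (16 * (D.r : ℝ) / ε ^ 2)
  rwa [div_le_iff₀ (pow_pos hε.1 2)] at this

end PLData

end SAA

theorem mainTheorem7 {m d : ℕ} (Θ : Set (SAA.E m)) (hΘ : IsCompact Θ) (hΘne : Θ.Nonempty)
    (PZ : Measure (SAA.E d)) [IsProbabilityMeasure PZ]
    (G : SAA.E m → SAA.E d → ℝ) (D : SAA.PLData m d) (hPL : D.Represents Θ G) :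
    (∀ θ ∈ Θ, ∀ i, Measurable (D.f i θ) ∧ Measurable (D.Gpart i θ)) ∧
    SAA.CondA1 Θ G ∧
    ((∀ i, MemLp (fun z => D.Λ i z) 2 PZ) →
      ∀ ξ : Fin D.r → SAA.E d → ℝ,
        (∀ i, SAA.IsPositiveEnvelope (SAA.goalClass Θ (D.f i)) (ξ i)) →
        (∀ i, ∃ M : ℝ, ∀ z, ξ i z ≤ M) →
        MemLp (D.envelope Θ ξ) 2 PZ ∧
        SAA.CondA2 Θ G PZ (D.envelope Θ ξ) ∧
        ∀ δ : ℝ, 0 < δ → δ ≤ 1 →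
          SAA.entropyIntegral (SAA.goalClass Θ G) (D.envelope Θ ξ) δ ≤
            ENNReal.ofReal (2 * δ * Real.sqrt
              ((∑ i, Real.log ((D.s i : ℝ) + 1))
                + (8 * (∑ i, (D.s i : ℝ)) + 30 * (D.r : ℝ) + 1) * Real.log 2
                + 2 * ((∑ i, (D.s i : ℝ)) + 3 * (D.r : ℝ)) *
                    (1 / 2 + Real.log ((D.r : ℝ) / δ))))) := by
  refine ⟨fun θ _ i => ⟨D.measurable_f i θ, D.measurable_Gpart i θ⟩, D.condA1 hPL,
    fun hΛ ξ hξ hbdd => ?_⟩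
  have hm : ∀ i, Measurable (ξ i) := fun i => (hξ i).1.1
  have hLp : MemLp (D.envelope Θ ξ) 2 PZ := D.memLp_envelope hΛ hm (fun i => (hξ i).2) hbdd
  refine ⟨hLp, ⟨⟨⟨D.measurable_envelope hm, ?_⟩, D.envelope_pos fun i => (hξ i).2⟩,
    hLp.integrable (by norm_num)⟩, fun δ hδ hδ1 => D.entropyIntegral_goalClass_le hΘ hPL hξ hδ hδ1⟩
  rintro _ ⟨θ, hθ, rfl⟩ z
  exact D.abs_le_envelope hΘ hPL hξ hθ z
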